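/- **Proposition (Vector-valued maximal inequality).** Let $p \in (1,\infty)$ and $r \in (1,\infty]$. There is a constant $C = C(p,r) < \infty$ such that the following holds for every probability space $(\Omega,\mathcal F,\mu)$ with a filtration $(\mathcal F_n)_{n\in\mathbb N}$, every Banach space $E$ (in particular $E=\mathbb R$ or $\mathbb C$), and every sequence $(f_k)_{k\in\mathbb N}$ of $E$-valued martingales $f_k = (f_{k,n})_{n\in\mathbb N}$ with respect to $(\mathcal F_n)$. Let $(Mf_k)_n := \sup_{j\le n} \|f_{k,j}\|_E$, and for a sequence $X_k = (X_{k,n})_n$ of processes let $$\|\ell^r_k X_k\|_{L^p} := \sup_{n\in\mathbb N} \Bigl\| \bigl( \sum_{k} \|X_{k,n}\|^r \bigr)^{1/r} \Bigr\|_{L^p(\mu)} \in [0,\infty],$$ where for $r=\infty$ the inner expression is $\sup_k \|X_{k,n}\|$. Then $$\|\ell^r_k M f_k\|_{L^p} \le C\, \|\ell^r_k f_k\|_{L^p}.$$ Moreover, with the same constant, $$\Bigl\| \bigl( \sum_{k} \bigl(\sup_{n\in\mathbb N} \|f_{k,n}\|_E\bigr)^r \bigr)^{1/r} \Bigr\|_{L^p(\mu)}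 \le C\, \|\ell^r_k f_k\|_{L^p}$$ (again with $\sup_k$ in place of the $\ell^r$ sum for $r=\infty$). -/

import Mathlib

open MeasureTheory
open scoped NNReal ENNReal

/-- The maximal process `(M f)_n = sup_{j ≤ n} ‖f_j‖` of a discrete-time process. -/
noncomputable def maximalProcess {Ω E : Type*} [ENorm E] (f : ℕ → Ω → E) (n : ℕ) (ω : Ω) :
    ℝ≥0∞ :=
  ⨆ (j : ℕ) (_ : j ≤ n), ‖f j ω‖ₑ

/-- The pointwise `ℓ^r` norm in `k` of a sequence `X = (X_k)_k` of random variables: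
`(∑ k, ‖X k ω‖ ^ r) ^ (1 / r)` for `0 < r < ∞` and `sup k, ‖X k ω‖` for `r = ∞`. It is the `L^r`
norm with respect to the counting measure on `ℕ`, with values in `[0, ∞]`. -/
noncomputable def ellNorm {Ω E : Type*} [ENorm E] (r : ℝ≥0∞) (X : ℕ → Ω → E) (ω : Ω) : ℝ≥0∞ :=
  eLpNorm (fun k => X k ω) r Measure.count

/-- The norm `‖ℓ^r_k X_k‖_{L^p}` of a sequence `X_k = (X_{k,n})_n` of processes. The `L^p` norm of
a process is the supremum over the times `n` of the `L^p` norms of its values. -/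
noncomputable def mixedNorm {Ω E : Type*} [ENorm E] {_ : MeasurableSpace Ω} (p r : ℝ≥0∞)
    (X : ℕ → ℕ → Ω → E) (μ : Measure Ω) : ℝ≥0∞ :=
  ⨆ n : ℕ, eLpNorm (ellNorm r (fun k => X k n)) p μ

/-!
The proof is carried out for families of nonnegative adapted processes `x k` up to a finite time
`N`, which satisfy `E[x k n | ℱ n] ≤ E[x k N | ℱ n]`; the norms of Banach space valued martingales
are of this kind. Monotone convergence then gives the statement with the supremum over all times.
Write `h k = x k N`, let `M x k` be the maximal function of `x k` up to time `N`, and put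
`F = (∑ k, h k ^ r) ^ (1 / r)` and `G = (∑ k, (M x k) ^ r) ^ (1 / r)`.

The scalar tool is Doob's `L^r` inequality (`lintegral_partialSups_rpow_le`), proved from a pathwise
bound on the increments of the maximal process. It needs only the inequalities between integrals
over `ℱ n`-measurable sets, and so can be applied under any finite measure. Apply it to the measure
`W μ`, where `W` is a weight with a lower bound `w n ≤ W` by an adapted process such that
`E[W | ℱ n] ≤ C w n` (`IsA1Weight`). Since `w n` can be moved across the conditional expectation
given `ℱ n`, this yields the weighted inequality `∫ (M x)^r W ≤ C' ∫ h^r W` and its dual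
`∫ (M x)^r W^(1-r) ≤ C' ∫ h^r W^(1-r)`. Both are linear in the `r`-th powers, so they sum over `k`.

Weights are supplied by maximal functions: if `H` is the maximal function of the martingale
`E[V | ℱ n] + c` with `c > 0`, then `H ^ δ` is such a weight for every `0 ≤ δ < 1`
(`isA1Weight_doobMax_rpow`), because with `A` the maximal process and `X` the martingale itself,
`(1 - δ) A ^ δ + δ A ^ (δ - 1) X` is a supermartingale.

* For `p ≤ r`, take `V = F` and `δ = (r - p) / (r - 1)`, so that `W ^ (1 - r) = H ^ (p - r)`. The
  dual inequality and `F ≤ H` bound `∫ G^r H^(p-r)` by `C' ∫ F^r H^(p-r) ≤ C' ∫ H^p`, and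
  `G^p ≤ G^r H^(p-r) + H^p` pointwise.
* For `p > r`, take `V = G ^ ((p - r) / δ)` with `δ < 1` close enough to `1` that `H ^ δ` lies in
  `L^(p / (p - r))`. Then `∫ G^p ≤ ∫ G^r W ≤ C' ∫ F^r W`, and after splitting `F^r W` the term with
  `W` is absorbed into the left-hand side. It is finite as long as the sum over `k` is finite.
* For `r = ∞`, all `x k n` are at most `E[sup_k h k | ℱ n]`, so Doob's inequality suffices.
-/

/-! ### Comparison of conditional expectations -/

/-- The conditional expectation of `x` given `m` is at most that of `h`. This is encoded by
comparing the integrals over all `m`-measurable sets, which involves no conditional expectations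
and no integrability. -/
def SetIntLE {Ω : Type*} (m : MeasurableSpace Ω) {mΩ : MeasurableSpace Ω} (μ : Measure Ω)
    (x h : Ω → ℝ≥0∞) : Prop :=
  ∀ s, MeasurableSet[m] s → ∫⁻ ω in s, x ω ∂μ ≤ ∫⁻ ω in s, h ω ∂μ

/-- The inequality extends from indicators to all nonnegative `m`-measurable multipliers `D`: it
compares the restrictions to `m` of the measures with densities `x` and `h`. -/
theorem SetIntLE.lintegral_mul_le {Ω : Type*} {m mΩ : MeasurableSpace Ω} {μ : Measure Ω}
    {x h D : Ω → ℝ≥0∞} (H : SetIntLE m μ x h) (hm : m ≤ mΩ) (hx : Measurable x)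
    (hh : Measurable h) (hD : Measurable[m] D) :
    ∫⁻ ω, D ω * x ω ∂μ ≤ ∫⁻ ω, D ω * h ω ∂μ := by
  have key : ∀ z : Ω → ℝ≥0∞, Measurable z →
      ∫⁻ ω, D ω * z ω ∂μ = ∫⁻ ω, D ω ∂((μ.withDensity z).trim hm) := by
    intro z hz
    rw [lintegral_trim hm hD, lintegral_withDensity_eq_lintegral_mul _ hz (hD.mono hm le_rfl)]
    simp only [Pi.mul_apply, mul_comm]
  rw [key x hx, key h hh]
  refine lintegral_mono' (Measure.le_iff.2 fun s hs => ?_) le_rfl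
  rw [trim_measurableSet_eq hm hs, trim_measurableSet_eq hm hs, withDensity_apply _ (hm s hs),
    withDensity_apply _ (hm s hs)]
  exact H s hs

theorem SetIntLE.setLIntegral_mul_le {Ω : Type*} {m mΩ : MeasurableSpace Ω} {μ : Measure Ω}
    {x h D : Ω → ℝ≥0∞} (H : SetIntLE m μ x h) (hm : m ≤ mΩ) (hx : Measurable x)
    (hh : Measurable h) (hD : Measurable[m] D) {s : Set Ω} (hs : MeasurableSet[m] s) :
    ∫⁻ ω in s, D ω * x ω ∂μ ≤ ∫⁻ ω in s, D ω * h ω ∂μ := by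
  have := H.lintegral_mul_le hm hx hh (hD.indicator hs)
  simp only [← Set.indicator_mul_left] at this
  rwa [lintegral_indicator (hm s hs), lintegral_indicator (hm s hs)] at this

/-! ### Doob's inequality -/

/-- The increment of the `r`-th power of a running maximum, where `b` is the old maximum and `y` the
new value. This is Young's inequality for `y * b ^ (r - 1)`. -/
theorem max_rpow_le_add_mul_sub {r q : ℝ} (hrq : r.HolderConjugate q) {b y : ℝ≥0∞} (hb : b ≠ ∞)
    (hy : y ≠ ∞) :
    (b ⊔ y) ^ r ≤ b ^ r + ENNReal.ofReal q * (y * ((b ⊔ y) ^ (r - 1) - b ^ (r - 1))) := by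
  rcases le_total y b with h | h
  · rw [sup_eq_left.2 h]; exact le_self_add
  rw [sup_eq_right.2 h]
  lift b to ℝ≥0 using hb
  lift y to ℝ≥0 using hy
  have hr := hrq.pos
  have hr1 : 0 < r - 1 := hrq.sub_one_pos
  have hq := hrq.symm.pos
  rw [← ENNReal.coe_rpow_of_nonneg _ hr.le, ← ENNReal.coe_rpow_of_nonneg _ hr.le,
    ← ENNReal.coe_rpow_of_nonneg _ hr1.le, ← ENNReal.coe_rpow_of_nonneg _ hr1.le,
    ENNReal.ofReal, ← ENNReal.coe_sub, ← ENNReal.coe_mul, ← ENNReal.coe_mul, ← ENNReal.coe_add,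
    ENNReal.coe_le_coe, ← NNReal.coe_le_coe]
  have hby : b ≤ y := by exact_mod_cast h
  have hsub : b ^ (r - 1) ≤ y ^ (r - 1) := NNReal.rpow_le_rpow hby hr1.le
  push_cast [NNReal.coe_sub hsub, Real.coe_toNNReal q hq.le]
  have young := Real.young_inequality_of_nonneg y.2 (Real.rpow_nonneg b.2 (r - 1)) hrq
  have e1 : ((b : ℝ) ^ (r - 1)) ^ q = (b : ℝ) ^ r := by
    rw [← Real.rpow_mul b.coe_nonneg, hrq.sub_one_mul_conj]
  have e2 : (y : ℝ) * (y : ℝ) ^ (r - 1) = (y : ℝ) ^ r := by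
    rcases eq_or_ne (y : ℝ) 0 with h0 | h0
    · rw [h0, Real.zero_rpow hr.ne', zero_mul]
    · rw [Real.rpow_sub_one h0]; field_simp
  change (y : ℝ) * (b : ℝ) ^ (r - 1) ≤ (y : ℝ) ^ r / r + ((b : ℝ) ^ (r - 1)) ^ q / q at young
  rw [e1] at young
  have e3 : q / r = q - 1 := by
    rw [div_eq_mul_inv, ← hrq.symm.one_sub_inv]; field_simp
  have := mul_le_mul_of_nonneg_left young hq.le
  have e4 : q * ((y : ℝ) ^ r / r + (b : ℝ) ^ r / q) = (q / r) * (y : ℝ) ^ r + (b : ℝ) ^ r := by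
    field_simp
  rw [e4, e3] at this
  rw [mul_sub, e2]
  linarith

/-- A form of Young's inequality with a free parameter `t`, used to absorb one of the terms. -/
theorem rpow_mul_rpow_le_add {a b t : ℝ≥0∞} {u v : ℝ} (hu : 0 ≤ u) (hv : 0 ≤ v)
    (ht : t ≠ 0) (ht' : t ≠ ∞) :
    a ^ u * b ^ v ≤ t ^ v * a ^ (u + v) + t ^ (-u) * b ^ (u + v) := by
  rcases le_total b (t * a) with h | h
  · refine le_trans ?_ le_self_add
    rw [ENNReal.rpow_add_of_nonneg _ _ hu hv, mul_left_comm, ← ENNReal.mul_rpow_of_nonneg _ _ hv]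
    gcongr
  · refine le_trans ?_ le_add_self
    rw [ENNReal.rpow_add_of_nonneg _ _ hu hv, ← mul_assoc, ENNReal.rpow_neg, ← ENNReal.inv_rpow,
      ← ENNReal.mul_rpow_of_nonneg _ _ hu]
    gcongr
    rw [← ENNReal.div_eq_inv_mul, ENNReal.le_div_iff_mul_le (.inl ht) (.inl ht'), mul_comm]
    exact h

theorem le_two_mul_of_le_add_half {I X : ℝ≥0∞} (hI : I ≠ ∞) (h : I ≤ X + 2⁻¹ * I) :
    I ≤ 2 * X := by
  have h2 : (2⁻¹ : ℝ≥0∞) * I ≠ ∞ := by finiteness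
  have e : I = 2⁻¹ * I + 2⁻¹ * I := by rw [← add_mul, ENNReal.inv_two_add_inv_two, one_mul]
  have h3 : 2⁻¹ * I ≤ X := by
    rw [← ENNReal.add_le_add_iff_right h2]; rwa [← e]
  calc I = 2 * (2⁻¹ * I) := by
        rw [← mul_assoc, ENNReal.mul_inv_cancel (by norm_num) (by norm_num), one_mul]
    _ ≤ 2 * X := by gcongr

theorem measurable_partialSups_adapted {Ω : Type*} {mΩ : MeasurableSpace Ω}
    {ℱ : Filtration ℕ mΩ} {y : ℕ → Ω → ℝ≥0∞} (hy : ∀ n, Measurable[ℱ n] (y n)) (n : ℕ) :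
    Measurable[ℱ n] (partialSups y n) := by
  induction n with
  | zero => simpa using hy 0
  | succ n ih =>
    rw [← Order.succ_eq_add_one, partialSups_succ]
    exact (ih.mono (ℱ.mono n.le_succ) le_rfl).sup (hy _)

theorem partialSups_inf_const {Ω : Type*} (y : ℕ → Ω → ℝ≥0∞) (K : ℝ≥0∞) (n : ℕ) (ω : Ω) :
    partialSups (fun n ω => y n ω ⊓ K) n ω = partialSups y n ω ⊓ K := by
  induction n with
  | zero => simp
  | succ n ih =>
    rw [← Order.succ_eq_add_one, partialSups_succ, partialSups_succ, Pi.sup_apply, Pi.sup_apply,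
      ih, inf_sup_right]

/-- Doob's inequality for a bounded process. Boundedness makes the left-hand side finite, which is
needed to absorb a part of it. -/
theorem lintegral_partialSups_rpow_le_of_bdd {Ω : Type*} {mΩ : MeasurableSpace Ω} {ν : Measure Ω}
    [IsFiniteMeasure ν] {ℱ : Filtration ℕ mΩ} {r q : ℝ} (hrq : r.HolderConjugate q)
    {y : ℕ → Ω → ℝ≥0∞} (hy : ∀ n, Measurable[ℱ n] (y n)) {g : Ω → ℝ≥0∞} (hg : Measurable g)
    {N : ℕ} (hyg : ∀ n ≤ N, SetIntLE (ℱ n) ν (y n) g) {K : ℝ≥0∞} (hK : K ≠ ∞)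
    (hyK : ∀ n ω, y n ω ≤ K) :
    ∫⁻ ω, partialSups y N ω ^ r ∂ν ≤ (2 * ENNReal.ofReal q) ^ r * ∫⁻ ω, g ω ^ r ∂ν := by
  have hr := hrq.pos
  have hr1 : 0 < r - 1 := hrq.sub_one_pos
  have hq := hrq.symm.pos
  have hMK : ∀ n ω, partialSups y n ω ≤ K := fun n ω => by
    have : partialSups y n ≤ fun _ => K := partialSups_le _ _ _ fun i _ ω => hyK i ω
    exact this ω
  have hM : ∀ n, Measurable[ℱ n] (partialSups y n) := measurable_partialSups_adapted hy
  have hM' : ∀ n, Measurable (partialSups y n) := fun n => (hM n).mono (ℱ.le n) le_rfl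
  have hy' : ∀ n, Measurable (y n) := fun n => (hy n).mono (ℱ.le n) le_rfl
  -- The multiplier `D` below is `ℱ (n + 1)`-measurable, so `y (n + 1)` can be replaced by `g`, and
  -- the resulting sum telescopes.
  have step : ∀ n, n ≤ N → ∫⁻ ω, partialSups y n ω ^ r ∂ν ≤
      ENNReal.ofReal q * ∫⁻ ω, partialSups y n ω ^ (r - 1) * g ω ∂ν := by
    intro n
    induction n with
    | zero =>
      intro h0
      have h1 := (hyg 0 h0).lintegral_mul_le (ℱ.le 0) (hy' 0) hg ((hy 0).pow_const (r - 1))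
      simp only [partialSups_zero]
      have e : ∀ ω, y 0 ω ^ r = y 0 ω ^ (r - 1) * y 0 ω := fun ω => by
        conv_rhs => rw [← ENNReal.rpow_one (y 0 ω), ← ENNReal.rpow_mul, one_mul]
        rw [← ENNReal.rpow_add_of_nonneg _ _ hr1.le zero_le_one]; simp
      simp only [e]
      refine h1.trans (le_mul_of_one_le_left zero_le ?_)
      rw [ENNReal.one_le_ofReal]; exact hrq.symm.lt.le
    | succ n ih =>
      intro hn
      set D : Ω → ℝ≥0∞ := fun ω => partialSups y (n + 1) ω ^ (r - 1) - partialSups y n ω ^ (r - 1)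
        with hDdef
      have hD : Measurable[ℱ (n + 1)] D := by
        refine Measurable.sub ((hM _).pow_const _) ?_
        exact ((hM n).mono (ℱ.mono n.le_succ) le_rfl).pow_const _
      have hD' : Measurable D := hD.mono (ℱ.le _) le_rfl
      have hle : ∀ ω, partialSups y n ω ≤ partialSups y (n + 1) ω := fun ω =>
        (partialSups y).mono n.le_succ ω
      have hpath : ∀ ω, partialSups y (n + 1) ω ^ r ≤
          partialSups y n ω ^ r + ENNReal.ofReal q * (D ω * y (n + 1) ω) := by
        intro ω
        have e : partialSups y (n + 1) ω = partialSups y n ω ⊔ y (n + 1) ω := by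
          rw [← Order.succ_eq_add_one, partialSups_succ, Pi.sup_apply]
        have := max_rpow_le_add_mul_sub hrq (ne_top_of_le_ne_top hK (hMK n ω))
          (ne_top_of_le_ne_top hK (hyK (n + 1) ω))
        rw [← e, mul_comm (y (n + 1) ω)] at this
        exact this
      calc ∫⁻ ω, partialSups y (n + 1) ω ^ r ∂ν
          ≤ ∫⁻ ω, (partialSups y n ω ^ r + ENNReal.ofReal q * (D ω * y (n + 1) ω)) ∂ν :=
            lintegral_mono hpath
        _ = ∫⁻ ω, partialSups y n ω ^ r ∂ν + ENNReal.ofReal q * ∫⁻ ω, D ω * y (n + 1) ω ∂ν := by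
            rw [lintegral_add_left ((hM' n).pow_const _), lintegral_const_mul _ (by fun_prop)]
        _ ≤ ENNReal.ofReal q * ∫⁻ ω, partialSups y n ω ^ (r - 1) * g ω ∂ν +
              ENNReal.ofReal q * ∫⁻ ω, D ω * g ω ∂ν := by
            refine add_le_add (ih (by omega)) (mul_le_mul_right ?_ _)
            exact (hyg _ hn).lintegral_mul_le (ℱ.le _) (hy' _) hg hD
        _ = ENNReal.ofReal q * ∫⁻ ω, partialSups y (n + 1) ω ^ (r - 1) * g ω ∂ν := by
            rw [← mul_add, ← lintegral_add_right _ (by fun_prop)]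
            congr 1
            refine lintegral_congr fun ω => ?_
            rw [← add_mul, hDdef, add_tsub_cancel_of_le (ENNReal.rpow_le_rpow (hle ω) hr1.le)]
  set I := ∫⁻ ω, partialSups y N ω ^ r ∂ν with hI
  set Q := ENNReal.ofReal q with hQ
  have hQ0 : Q ≠ 0 := by simpa [hQ] using hq
  have hQt : Q ≠ ∞ := by simp [hQ]
  have hIfin : I ≠ ∞ := by
    refine ne_top_of_le_ne_top (b := ∫⁻ _, K ^ r ∂ν) ?_
      (lintegral_mono fun ω => ENNReal.rpow_le_rpow (hMK N ω) hr.le)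
    rw [lintegral_const]
    exact ENNReal.mul_ne_top (ENNReal.rpow_ne_top_of_nonneg hr.le hK) (measure_ne_top _ _)
  have main : I ≤ Q * (2 * Q) ^ (r - 1) * ∫⁻ ω, g ω ^ r ∂ν + 2⁻¹ * I := by
    calc I ≤ Q * ∫⁻ ω, partialSups y N ω ^ (r - 1) * g ω ∂ν := step N le_rfl
      _ ≤ Q * ∫⁻ ω, ((2 * Q) ^ (r - 1) * g ω ^ r +
            (2 * Q)⁻¹ * partialSups y N ω ^ r) ∂ν := by
          gcongr with ω
          have := rpow_mul_rpow_le_add (a := g ω) (b := partialSups y N ω) (t := 2 * Q)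
            zero_le_one hr1.le (by simp [hQ0]) (by finiteness)
          rwa [ENNReal.rpow_one, add_sub_cancel, ENNReal.rpow_neg_one, mul_comm (g ω)] at this
      _ = Q * (2 * Q) ^ (r - 1) * ∫⁻ ω, g ω ^ r ∂ν + 2⁻¹ * I := by
          rw [lintegral_add_left (by fun_prop), lintegral_const_mul _ (by fun_prop),
            lintegral_const_mul _ ((hM' N).pow_const _), mul_add, ← mul_assoc, ← mul_assoc Q]
          congr 2
          rw [ENNReal.mul_inv (by simp) (by simp), mul_left_comm, ENNReal.mul_inv_cancel hQ0 hQt,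
            mul_one]
  refine (le_two_mul_of_le_add_half hIfin main).trans_eq ?_
  rw [← mul_assoc, ← mul_assoc]
  congr 1
  conv_lhs => rw [← ENNReal.rpow_one (2 * Q)]
  rw [← ENNReal.rpow_mul, one_mul, ← ENNReal.rpow_add_of_nonneg _ _ zero_le_one hr1.le]
  simp

/-- Doob's `L^r` maximal inequality for an adapted process `y` with `E[y n | ℱ n] ≤ E[g | ℱ n]` up
to time `N`, with respect to a finite measure. -/
theorem lintegral_partialSups_rpow_le {Ω : Type*} {mΩ : MeasurableSpace Ω} {ν : Measure Ω}
    [IsFiniteMeasure ν] {ℱ : Filtration ℕ mΩ} {r q : ℝ} (hrq : r.HolderConjugate q)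
    {y : ℕ → Ω → ℝ≥0∞} (hy : ∀ n, Measurable[ℱ n] (y n)) {g : Ω → ℝ≥0∞} (hg : Measurable g)
    {N : ℕ} (hyg : ∀ n ≤ N, SetIntLE (ℱ n) ν (y n) g) :
    ∫⁻ ω, partialSups y N ω ^ r ∂ν ≤ (2 * ENNReal.ofReal q) ^ r * ∫⁻ ω, g ω ^ r ∂ν := by
  have hr := hrq.pos
  have hM : Measurable (partialSups y N) :=
    (measurable_partialSups_adapted hy N).mono (ℱ.le N) le_rfl
  -- Truncation at the level `K` preserves the hypotheses.
  have e : ∀ ω, partialSups y N ω ^ r = ⨆ K : ℕ, (partialSups y N ω ⊓ (K : ℝ≥0∞)) ^ r := by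
    intro ω
    have h1 := (ENNReal.orderIsoRpow r hr).map_iSup fun K : ℕ => partialSups y N ω ⊓ (K : ℝ≥0∞)
    simp only [ENNReal.orderIsoRpow_apply] at h1
    rw [← h1, ← inf_iSup_eq, ENNReal.iSup_natCast, inf_top_eq]
  simp only [e]
  have hmeas : ∀ K : ℕ, Measurable fun ω => (partialSups y N ω ⊓ (K : ℝ≥0∞)) ^ r :=
    fun K => (hM.inf measurable_const).pow_const r
  rw [lintegral_iSup hmeas]
  · refine iSup_le fun K => ?_
    have := lintegral_partialSups_rpow_le_of_bdd hrq (y := fun n ω => y n ω ⊓ (K : ℝ≥0∞))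
      (fun n => (hy n).inf measurable_const) hg (N := N)
      (fun n hn s hs => (lintegral_mono fun ω => inf_le_left).trans (hyg n hn s hs))
      (ENNReal.natCast_ne_top K) (fun n ω => inf_le_right)
    simpa only [partialSups_inf_const] using this
  · intro a b hab ω
    exact ENNReal.rpow_le_rpow (inf_le_inf_left _ (by exact_mod_cast hab)) hr.le

/-! ### Weighted maximal inequalities -/

theorem lintegral_withDensity_eq_mul {Ω : Type*} {mΩ : MeasurableSpace Ω} {μ : Measure Ω}
    {W g : Ω → ℝ≥0∞} (hW : Measurable W) (hg : Measurable g) :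
    ∫⁻ ω, g ω ∂(μ.withDensity W) = ∫⁻ ω, g ω * W ω ∂μ := by
  rw [lintegral_withDensity_eq_lintegral_mul _ hW hg]
  simp only [Pi.mul_apply, mul_comm]

theorem setLIntegral_withDensity_eq_mul {Ω : Type*} {mΩ : MeasurableSpace Ω} {μ : Measure Ω}
    {W g : Ω → ℝ≥0∞} (hW : Measurable W) (hg : Measurable g) {s : Set Ω} (hs : MeasurableSet s) :
    ∫⁻ ω in s, g ω ∂(μ.withDensity W) = ∫⁻ ω in s, g ω * W ω ∂μ := by
  rw [restrict_withDensity hs, lintegral_withDensity_eq_mul hW hg]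

/-- An `A₁` weight up to time `N`, with constant `C`. In the classical condition
`E[W | ℱ n] ≤ C W` the weight on the right is replaced by an adapted process `w`, nowhere zero and
with `w n ≤ W`, so that `w n` can be taken out of conditional expectations given `ℱ n`. -/
structure IsA1Weight {Ω : Type*} {mΩ : MeasurableSpace Ω} (ℱ : Filtration ℕ mΩ) (μ : Measure Ω)
    (N : ℕ) (C : ℝ≥0∞) (W : Ω → ℝ≥0∞) (w : ℕ → Ω → ℝ≥0∞) : Prop where
  measurable : Measurable W
  adapted : ∀ n, Measurable[ℱ n] (w n)
  le_mul : ∀ n ≤ N, SetIntLE (ℱ n) μ W (fun ω => C * w n ω)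
  le : ∀ n ≤ N, ∀ ω, w n ω ≤ W ω
  ne_zero : ∀ n ω, w n ω ≠ 0
  lintegral_ne_top : ∫⁻ ω, W ω ∂μ ≠ ∞

namespace IsA1Weight

variable {Ω : Type*} {mΩ : MeasurableSpace Ω} {ℱ : Filtration ℕ mΩ} {μ : Measure Ω}
    {N : ℕ} {C : ℝ≥0∞} {W : Ω → ℝ≥0∞} {w : ℕ → Ω → ℝ≥0∞}

/-- The maximal inequality with respect to an `A₁` weight: under `W μ`, the process `x` is dominated
by `C * h`. -/
theorem lintegral_partialSups_rpow_mul_le (hW : IsA1Weight ℱ μ N C W w) {r q : ℝ}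
    (hrq : r.HolderConjugate q) {x : ℕ → Ω → ℝ≥0∞} (hx : ∀ n, Measurable[ℱ n] (x n))
    {h : Ω → ℝ≥0∞} (hh : Measurable h) (hxh : ∀ n ≤ N, SetIntLE (ℱ n) μ (x n) h) :
    ∫⁻ ω, partialSups x N ω ^ r * W ω ∂μ ≤
      (2 * ENNReal.ofReal q * C) ^ r * ∫⁻ ω, h ω ^ r * W ω ∂μ := by
  have hWm := hW.measurable
  have hx' : ∀ n, Measurable (x n) := fun n => (hx n).mono (ℱ.le n) le_rfl
  have hw' : ∀ n, Measurable (w n) := fun n => (hW.adapted n).mono (ℱ.le n) le_rfl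
  have : IsFiniteMeasure (μ.withDensity W) := isFiniteMeasure_withDensity hW.lintegral_ne_top
  have key := lintegral_partialSups_rpow_le (ν := μ.withDensity W) hrq hx (g := fun ω => C * h ω)
    (by fun_prop) (N := N) fun n hn s hs => by
      rw [setLIntegral_withDensity_eq_mul hWm (hx' n) (ℱ.le n s hs),
        setLIntegral_withDensity_eq_mul hWm (by fun_prop) (ℱ.le n s hs)]
      calc ∫⁻ ω in s, x n ω * W ω ∂μ ≤ ∫⁻ ω in s, x n ω * (C * w n ω) ∂μ :=
            (hW.le_mul n hn).setLIntegral_mul_le (ℱ.le n) hWm (by fun_prop) (hx n) hs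
        _ = ∫⁻ ω in s, (C * w n ω) * x n ω ∂μ := by simp only [mul_comm]
        _ ≤ ∫⁻ ω in s, (C * w n ω) * h ω ∂μ :=
            (hxh n hn).setLIntegral_mul_le (ℱ.le n) (hx' n) hh
              ((hW.adapted n).const_mul C) hs
        _ ≤ ∫⁻ ω in s, C * h ω * W ω ∂μ := by
            refine lintegral_mono fun ω => ?_
            rw [mul_right_comm]
            exact mul_le_mul_right (hW.le n hn ω) _
  have hM : Measurable (partialSups x N) :=
    (measurable_partialSups_adapted hx N).mono (ℱ.le N) le_rfl
  have hr := hrq.pos.le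
  rw [lintegral_withDensity_eq_mul hWm (by fun_prop),
    lintegral_withDensity_eq_mul hWm (by fun_prop)] at key
  refine key.trans_eq ?_
  rw [ENNReal.mul_rpow_of_nonneg (2 * ENNReal.ofReal q) C hr, mul_assoc,
    ← lintegral_const_mul (C ^ r) (by fun_prop)]
  simp only [ENNReal.mul_rpow_of_nonneg C _ hr, mul_assoc]

/-- The maximal inequality with respect to the weight `W ^ (1 - r)`: under `W μ`, the process
`x n / w n` is dominated by `C * h / W`, and `M x ≤ W * M (x / w)`. -/
theorem lintegral_partialSups_rpow_mul_rpow_le (hW : IsA1Weight ℱ μ N C W w) {r q : ℝ}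
    (hrq : r.HolderConjugate q) {x : ℕ → Ω → ℝ≥0∞} (hx : ∀ n, Measurable[ℱ n] (x n))
    {h : Ω → ℝ≥0∞} (hh : Measurable h) (hxh : ∀ n ≤ N, SetIntLE (ℱ n) μ (x n) h) :
    ∫⁻ ω, partialSups x N ω ^ r * W ω ^ (1 - r) ∂μ ≤
      (2 * ENNReal.ofReal q * C) ^ r * ∫⁻ ω, h ω ^ r * W ω ^ (1 - r) ∂μ := by
  have hWm := hW.measurable
  have hr := hrq.pos.le
  have hx' : ∀ n, Measurable (x n) := fun n => (hx n).mono (ℱ.le n) le_rfl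
  have hw' : ∀ n, Measurable (w n) := fun n => (hW.adapted n).mono (ℱ.le n) le_rfl
  have hWtop : ∀ᵐ ω ∂μ, W ω ≠ ∞ :=
    (ae_lt_top hWm hW.lintegral_ne_top).mono fun _ h => h.ne
  have hW0 : ∀ ω, W ω ≠ 0 := fun ω =>
    (lt_of_lt_of_le (pos_iff_ne_zero.2 (hW.ne_zero 0 ω)) (hW.le 0 (Nat.zero_le _) ω)).ne'
  have : IsFiniteMeasure (μ.withDensity W) := isFiniteMeasure_withDensity hW.lintegral_ne_top
  set y : ℕ → Ω → ℝ≥0∞ := fun n ω => x n ω * (w n ω)⁻¹ with hy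
  have hyad : ∀ n, Measurable[ℱ n] (y n) := fun n => (hx n).mul (hW.adapted n).inv
  have hy' : ∀ n, Measurable (y n) := fun n => (hyad n).mono (ℱ.le n) le_rfl
  have key := lintegral_partialSups_rpow_le (ν := μ.withDensity W) hrq hyad
    (g := fun ω => C * (h ω * (W ω)⁻¹)) (by fun_prop) (N := N) fun n hn s hs => by
      rw [setLIntegral_withDensity_eq_mul hWm (hy' n) (ℱ.le n s hs),
        setLIntegral_withDensity_eq_mul hWm (by fun_prop) (ℱ.le n s hs)]
      calc ∫⁻ ω in s, y n ω * W ω ∂μ ≤ ∫⁻ ω in s, y n ω * (C * w n ω) ∂μ :=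
            (hW.le_mul n hn).setLIntegral_mul_le (ℱ.le n) hWm (by fun_prop) (hyad n) hs
        _ ≤ ∫⁻ ω in s, C * x n ω ∂μ := by
            refine lintegral_mono fun ω => ?_
            calc x n ω * (w n ω)⁻¹ * (C * w n ω) = C * x n ω * ((w n ω)⁻¹ * w n ω) := by ring
              _ ≤ C * x n ω * 1 := by gcongr; exact ENNReal.inv_mul_le_one _
              _ = C * x n ω := mul_one _
        _ ≤ ∫⁻ ω in s, C * h ω ∂μ := by
            rw [lintegral_const_mul _ (hx' n), lintegral_const_mul _ hh]
            gcongr 1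
            exact hxh n hn s hs
        _ = ∫⁻ ω in s, C * (h ω * (W ω)⁻¹) * W ω ∂μ := by
            refine lintegral_congr_ae (ae_restrict_of_ae ?_)
            filter_upwards [hWtop] with ω hω
            rw [mul_assoc, mul_assoc, ENNReal.inv_mul_cancel (hW0 ω) hω, mul_one]
  have hMx : Measurable (partialSups x N) :=
    (measurable_partialSups_adapted hx N).mono (ℱ.le N) le_rfl
  have hMy : Measurable (partialSups y N) :=
    (measurable_partialSups_adapted hyad N).mono (ℱ.le N) le_rfl
  rw [lintegral_withDensity_eq_mul hWm (by fun_prop),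
    lintegral_withDensity_eq_mul hWm (by fun_prop)] at key
  have hpow : ∀ ω, W ω ≠ ∞ → (W ω) ^ (1 - r) = (W ω)⁻¹ ^ r * W ω := fun ω hω => by
    rw [ENNReal.inv_rpow, ← ENNReal.rpow_neg]
    conv_rhs => rw [← ENNReal.rpow_one (W ω), ← ENNReal.rpow_mul, one_mul]
    rw [← ENNReal.rpow_add _ _ (hW0 ω) hω]
    ring_nf
  calc ∫⁻ ω, partialSups x N ω ^ r * W ω ^ (1 - r) ∂μ
      ≤ ∫⁻ ω, partialSups y N ω ^ r * W ω ∂μ := by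
        refine lintegral_mono_ae ?_
        filter_upwards [hWtop] with ω hω
        rw [hpow ω hω, ← mul_assoc, ← ENNReal.mul_rpow_of_nonneg _ _ hr]
        gcongr
        rw [← div_eq_mul_inv]
        refine ENNReal.div_le_of_le_mul ?_
        rw [Pi.partialSups_apply]
        refine partialSups_le (fun n => x n ω) _ _ fun n hn => ?_
        have hwn : w n ω ≠ ∞ := ne_top_of_le_ne_top hω (hW.le n hn ω)
        calc x n ω = y n ω * w n ω := by
              rw [hy, mul_assoc, ENNReal.inv_mul_cancel (hW.ne_zero n ω) hwn, mul_one]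
          _ ≤ partialSups y N ω * W ω :=
              mul_le_mul' (le_partialSups_of_le y hn ω) (hW.le n hn ω)
    _ ≤ _ := key
    _ = _ := by
        rw [ENNReal.mul_rpow_of_nonneg (2 * ENNReal.ofReal q) C hr, mul_assoc,
          ← lintegral_const_mul (C ^ r) (by fun_prop)]
        congr 1
        refine lintegral_congr_ae ?_
        filter_upwards [hWtop] with ω hω
        rw [hpow ω hω, ENNReal.mul_rpow_of_nonneg _ _ hr, ENNReal.mul_rpow_of_nonneg _ _ hr]
        ring

end IsA1Weight

/-! ### Maximal functions as weights -/

/-- The concave function `b ↦ b ^ δ` lies below its tangent at `a`. -/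
theorem rpow_le_tangent {a b : ℝ≥0∞} (ha : a ≠ 0) (ha' : a ≠ ∞) (hb' : b ≠ ∞) {δ : ℝ} (hδ : 0 ≤ δ)
    (hδ1 : δ < 1) :
    b ^ δ ≤ ENNReal.ofReal (1 - δ) * a ^ δ + ENNReal.ofReal δ * (a ^ (δ - 1) * b) := by
  lift a to ℝ≥0 using ha'
  lift b to ℝ≥0 using hb'
  have ha0 : a ≠ 0 := by simpa using ha
  rw [← ENNReal.coe_rpow_of_nonneg _ hδ, ← ENNReal.coe_rpow_of_nonneg _ hδ,
    ← ENNReal.coe_rpow_of_ne_zero ha0, ENNReal.ofReal, ENNReal.ofReal]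
  norm_cast
  have := NNReal.geom_mean_le_arith_mean2_weighted (Real.toNNReal (1 - δ)) (Real.toNNReal δ)
    (a ^ δ) (a ^ (δ - 1) * b) (by
      rw [← Real.toNNReal_add (by linarith) hδ]; simp)
  refine le_trans (le_of_eq ?_) this
  rw [Real.coe_toNNReal _ (by linarith), Real.coe_toNNReal _ hδ, NNReal.mul_rpow,
    ← NNReal.rpow_mul, ← NNReal.rpow_mul, ← mul_assoc, ← NNReal.rpow_add ha0]
  rw [show δ * (1 - δ) + (δ - 1) * δ = 0 by ring, NNReal.rpow_zero, one_mul]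

theorem rpow_le_one_add {a : ℝ≥0∞} {δ : ℝ} (hδ : 0 ≤ δ) (hδ1 : δ ≤ 1) : a ^ δ ≤ 1 + a := by
  rcases le_total a 1 with h | h
  · exact (ENNReal.rpow_le_one h hδ).trans le_self_add
  · exact ((ENNReal.rpow_le_rpow_of_exponent_le h hδ1).trans_eq (ENNReal.rpow_one a)).trans
      le_add_self

/-- The maximal process of the martingale `E[F | ℱ n] + c`. The constant `c` is added after taking
conditional expectations, so that for `c > 0` the process is positive everywhere and not only almost
everywhere. -/
noncomputable def doobMax {Ω : Type*} {mΩ : MeasurableSpace Ω} (ℱ : Filtration ℕ mΩ)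
    (μ : Measure Ω) (F : Ω → ℝ≥0∞) (c : ℝ≥0∞) : ℕ → Ω → ℝ≥0∞ :=
  partialSups fun n ω => μ⁻[F|ℱ n] ω + c

section doobMax

variable {Ω : Type*} {mΩ : MeasurableSpace Ω} {ℱ : Filtration ℕ mΩ} {μ : Measure Ω}
  {F : Ω → ℝ≥0∞} {c : ℝ≥0∞}

theorem measurable_doobMax (n : ℕ) : Measurable[ℱ n] (doobMax ℱ μ F c n) :=
  measurable_partialSups_adapted (fun n => (measurable_condLExp (ℱ n) μ F).add_const c) n

/-- The bound holds everywhere, since `condLExp` leaves measurable functions unchanged. -/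
theorem le_doobMax [IsFiniteMeasure μ] {N : ℕ} (hF : Measurable[ℱ N] F) (ω : Ω) :
    F ω ≤ doobMax ℱ μ F c N ω := by
  refine le_trans ?_ (le_partialSups (fun n ω => μ⁻[F|ℱ n] ω + c) N ω)
  beta_reduce
  rw [condLExp_eq_self (ℱ.le N) μ hF]
  exact le_self_add

theorem const_le_doobMax (n : ℕ) (ω : Ω) : c ≤ doobMax ℱ μ F c n ω :=
  le_trans le_add_self (le_partialSups_of_le (fun n ω => μ⁻[F|ℱ n] ω + c) (Nat.zero_le n) ω)

theorem doobMax_mono {n N : ℕ} (h : n ≤ N) (ω : Ω) :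
    doobMax ℱ μ F c n ω ≤ doobMax ℱ μ F c N ω :=
  (partialSups fun n ω => μ⁻[F|ℱ n] ω + c).mono h ω

theorem doobMax_ne_top (hF : ∫⁻ ω, F ω ∂μ ≠ ∞) (hc : c ≠ ∞) :
    ∀ᵐ ω ∂μ, ∀ n, doobMax ℱ μ F c n ω ≠ ∞ := by
  rw [ae_all_iff]
  intro n
  induction n with
  | zero =>
    filter_upwards [condLExp_ne_top (mΩ := ℱ 0) hF] with ω h0
    simpa [doobMax] using ⟨h0, hc⟩
  | succ n ih =>
    filter_upwards [condLExp_ne_top (mΩ := ℱ (n + 1)) hF, ih] with ω h0 h1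
    rw [doobMax, ← Order.succ_eq_add_one, partialSups_succ, Pi.sup_apply]
    exact (max_lt h1.lt_top (by simpa using ⟨h0.lt_top, hc.lt_top⟩)).ne

theorem setIntLE_condLExp_add [IsFiniteMeasure μ] (n : ℕ) :
    SetIntLE (ℱ n) μ (fun ω => μ⁻[F|ℱ n] ω + c) (fun ω => F ω + c) := fun s hs => by
  rw [lintegral_add_right _ measurable_const, lintegral_add_right _ measurable_const,
    setLIntegral_condLExp (ℱ.le n) μ F hs]

theorem lintegral_doobMax_rpow_le [IsFiniteMeasure μ] {r q : ℝ} (hrq : r.HolderConjugate q)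
    (hF : Measurable F) (N : ℕ) : ∫⁻ ω, doobMax ℱ μ F c N ω ^ r ∂μ ≤
      (2 * ENNReal.ofReal q) ^ r * ∫⁻ ω, (F ω + c) ^ r ∂μ :=
  lintegral_partialSups_rpow_le hrq (fun n => (measurable_condLExp (ℱ n) μ F).add_const c)
    (hF.add_const c) fun n _ => setIntLE_condLExp_add n

/-- Powers of a maximal function with exponent `δ < 1` are `A₁` weights, with constant
`1 / (1 - δ)`. -/
theorem isA1Weight_doobMax_rpow [IsFiniteMeasure μ] (hF : ∫⁻ ω, F ω ∂μ ≠ ∞) (hc : c ≠ 0)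
    (hc' : c ≠ ∞) {δ : ℝ} (hδ : 0 ≤ δ) (hδ1 : δ < 1) (N : ℕ) :
    IsA1Weight ℱ μ N (ENNReal.ofReal (1 - δ))⁻¹ (fun ω => doobMax ℱ μ F c N ω ^ δ)
      (fun n ω => doobMax ℱ μ F c n ω ^ δ) := by
  set A := doobMax ℱ μ F c with hA
  set X : ℕ → Ω → ℝ≥0∞ := fun n ω => μ⁻[F|ℱ n] ω + c with hX
  have hXm : ∀ n, Measurable[ℱ n] (X n) := fun n => (measurable_condLExp (ℱ n) μ F).add_const c
  have hXm' : ∀ n, Measurable (X n) := fun n => (hXm n).mono (ℱ.le n) le_rfl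
  have hAm : ∀ n, Measurable[ℱ n] (A n) := measurable_doobMax
  have hAm' : ∀ n, Measurable (A n) := fun n => (hAm n).mono (ℱ.le n) le_rfl
  have hA0 : ∀ n ω, A n ω ≠ 0 := fun n ω =>
    ((pos_iff_ne_zero.2 hc).trans_le (const_le_doobMax n ω)).ne'
  have hAtop : ∀ᵐ ω ∂μ, ∀ n, A n ω ≠ ∞ := doobMax_ne_top hF hc'
  have hXA : ∀ n ω, X n ω ≤ A n ω := fun n ω => le_partialSups X n ω
  have hsucc : ∀ n ω, A (n + 1) ω = A n ω ⊔ X (n + 1) ω := fun n ω => by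
    rw [hA, doobMax, ← Order.succ_eq_add_one, partialSups_succ, Pi.sup_apply]
  -- `Z` is a supermartingale lying between `(1 - δ) A ^ δ` and `A ^ δ`.
  set Z : ℕ → Ω → ℝ≥0∞ := fun n ω =>
    ENNReal.ofReal (1 - δ) * A n ω ^ δ + ENNReal.ofReal δ * (A n ω ^ (δ - 1) * X n ω) with hZ
  have hsum : ENNReal.ofReal (1 - δ) + ENNReal.ofReal δ = 1 := by
    rw [← ENNReal.ofReal_add (by linarith) hδ]; simp
  have hmulpow : ∀ n ω, A n ω ≠ ∞ → A n ω ^ (δ - 1) * A n ω = A n ω ^ δ := fun n ω h => by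
    conv_lhs => rw [← ENNReal.rpow_one (A n ω), ← ENNReal.rpow_mul, one_mul]
    rw [← ENNReal.rpow_add _ _ (hA0 n ω) h]; ring_nf
  have hZA : ∀ n ω, A n ω ≠ ∞ → Z n ω ≤ A n ω ^ δ := fun n ω h => by
    calc Z n ω ≤ ENNReal.ofReal (1 - δ) * A n ω ^ δ +
            ENNReal.ofReal δ * (A n ω ^ (δ - 1) * A n ω) := by
          simp only [hZ]; gcongr; exact hXA n ω
      _ = A n ω ^ δ := by rw [hmulpow n ω h, ← add_mul, hsum, one_mul]
  have hstep : ∀ n ω, A n ω ≠ ∞ → A (n + 1) ω ≠ ∞ → Z (n + 1) ω ≤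
      ENNReal.ofReal (1 - δ) * A n ω ^ δ + ENNReal.ofReal δ * (A n ω ^ (δ - 1) * X (n + 1) ω) := by
    intro n ω h h'
    rcases le_total (X (n + 1) ω) (A n ω) with hle | hle
    · simp only [hZ]; rw [hsucc, sup_eq_left.2 hle]
    · have e : A (n + 1) ω = X (n + 1) ω := by rw [hsucc, sup_eq_right.2 hle]
      refine (hZA (n + 1) ω h').trans ?_
      rw [e]
      exact rpow_le_tangent (hA0 n ω) h (e ▸ h') hδ hδ1
  have hXset : ∀ n, SetIntLE (ℱ n) μ (X (n + 1)) (X n) := fun n s hs => by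
    rw [hX, lintegral_add_right _ measurable_const, lintegral_add_right _ measurable_const,
      setLIntegral_condLExp (ℱ.le n) μ F hs,
      setLIntegral_condLExp (ℱ.le _) μ F (ℱ.mono n.le_succ s hs)]
  have hZset : ∀ n, SetIntLE (ℱ n) μ (Z (n + 1)) (Z n) := fun n s hs => by
    calc ∫⁻ ω in s, Z (n + 1) ω ∂μ ≤ ∫⁻ ω in s, (ENNReal.ofReal (1 - δ) * A n ω ^ δ +
            ENNReal.ofReal δ * (A n ω ^ (δ - 1) * X (n + 1) ω)) ∂μ := by
          refine lintegral_mono_ae (ae_restrict_of_ae ?_)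
          filter_upwards [hAtop] with ω h using hstep n ω (h n) (h (n + 1))
      _ ≤ ∫⁻ ω in s, Z n ω ∂μ := by
          simp only [hZ]
          rw [lintegral_add_left (by fun_prop), lintegral_add_left (by fun_prop),
            lintegral_const_mul _ (by fun_prop), lintegral_const_mul (ENNReal.ofReal δ)
              (by fun_prop), lintegral_const_mul (ENNReal.ofReal δ) (by fun_prop)]
          gcongr 2
          exact (hXset n).setLIntegral_mul_le (ℱ.le n) (hXm' _) (hXm' _)
            ((hAm n).pow_const _) hs
  have hZset' : ∀ n m, n ≤ m → SetIntLE (ℱ n) μ (Z m) (Z n) := by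
    intro n m h
    induction m, h using Nat.le_induction with
    | base => exact fun s _ => le_rfl
    | succ m hm ih => exact fun s hs => (hZset m s (ℱ.mono hm s hs)).trans (ih s hs)
  have h1δ : ENNReal.ofReal (1 - δ) ≠ 0 := by simpa using hδ1
  have hAset : ∀ n ≤ N, SetIntLE (ℱ n) μ (fun ω => A N ω ^ δ)
      (fun ω => (ENNReal.ofReal (1 - δ))⁻¹ * A n ω ^ δ) := fun n hn s hs => by
    rw [lintegral_const_mul _ (by fun_prop), ← ENNReal.div_eq_inv_mul,
      ENNReal.le_div_iff_mul_le (.inl h1δ) (.inl ENNReal.ofReal_ne_top), mul_comm,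
      ← lintegral_const_mul _ (by fun_prop)]
    calc ∫⁻ ω in s, ENNReal.ofReal (1 - δ) * A N ω ^ δ ∂μ ≤ ∫⁻ ω in s, Z N ω ∂μ :=
          lintegral_mono fun ω => le_self_add
      _ ≤ ∫⁻ ω in s, Z n ω ∂μ := hZset' n N hn s hs
      _ ≤ ∫⁻ ω in s, A n ω ^ δ ∂μ := by
          refine lintegral_mono_ae (ae_restrict_of_ae ?_)
          filter_upwards [hAtop] with ω h using hZA n ω (h n)
  refine ⟨by fun_prop, fun n => (hAm n).pow_const _, hAset,
    fun n hn ω => ENNReal.rpow_le_rpow (doobMax_mono hn ω) hδ, fun n ω h => ?_, ?_⟩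
  · rcases ENNReal.rpow_eq_zero_iff.1 h with h | h
    · exact hA0 n ω h.1
    · linarith [h.2]
  · have h1 := hAset 0 (Nat.zero_le _) Set.univ MeasurableSet.univ
    rw [Measure.restrict_univ] at h1
    refine ne_top_of_le_ne_top ?_ (h1.trans (lintegral_mono fun ω =>
      mul_le_mul_right (rpow_le_one_add (a := A 0 ω) hδ hδ1.le) _))
    rw [lintegral_const_mul _ (by fun_prop), lintegral_add_left measurable_const]
    refine ENNReal.mul_ne_top (by simpa using hδ1) (ENNReal.add_ne_top.2 ⟨by simp, ?_⟩)
    have : A 0 = X 0 := by rw [hA, doobMax, partialSups_zero]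
    rw [this, hX, lintegral_add_right _ measurable_const, lintegral_condLExp (ℱ.le 0)]
    exact ENNReal.add_ne_top.2 ⟨hF, by rw [lintegral_const]; finiteness⟩

end doobMax

/-! ### The inequality for nonnegative processes at a fixed time -/

theorem measurable_tsum_rpow_rpow {Ω : Type*} {m : MeasurableSpace Ω} {X : ℕ → Ω → ℝ≥0∞}
    (hX : ∀ k, Measurable[m] (X k)) (r s : ℝ) : Measurable[m] fun ω => (∑' k, X k ω ^ r) ^ s :=
  (Measurable.tsum fun k => (hX k).pow_const r).pow_const s

theorem le_one_add_rpow {a : ℝ≥0∞} {p : ℝ} (hp : 1 ≤ p) : a ≤ 1 + a ^ p := by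
  rcases le_total a 1 with h | h
  · exact h.trans le_self_add
  · exact ((ENNReal.rpow_one a).symm.le.trans (ENNReal.rpow_le_rpow_of_exponent_le h hp)).trans
      le_add_self

theorem lintegral_ne_top_of_lintegral_rpow_ne_top {Ω : Type*} {mΩ : MeasurableSpace Ω}
    {μ : Measure Ω} [IsFiniteMeasure μ] {F : Ω → ℝ≥0∞} {p : ℝ} (hp : 1 ≤ p)
    (hFp : ∫⁻ ω, F ω ^ p ∂μ ≠ ∞) : ∫⁻ ω, F ω ∂μ ≠ ∞ := by
  refine ne_top_of_le_ne_top ?_ (lintegral_mono fun ω => le_one_add_rpow (a := F ω) hp)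
  rw [lintegral_add_left measurable_const, lintegral_const]
  finiteness

theorem lintegral_add_const_rpow_le {Ω : Type*} {mΩ : MeasurableSpace Ω}
    {μ : Measure Ω} [IsProbabilityMeasure μ] {F : Ω → ℝ≥0∞} (hF : Measurable F) {p : ℝ}
    (hp : 1 ≤ p) (c : ℝ≥0∞) :
    ∫⁻ ω, (F ω + c) ^ p ∂μ ≤ 2 ^ (p - 1) * (∫⁻ ω, F ω ^ p ∂μ + c ^ p) := by
  calc ∫⁻ ω, (F ω + c) ^ p ∂μ ≤ ∫⁻ ω, 2 ^ (p - 1) * (F ω ^ p + c ^ p) ∂μ :=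
        lintegral_mono fun ω => ENNReal.rpow_add_le_mul_rpow_add_rpow _ _ hp
    _ = _ := by
        rw [lintegral_const_mul _ (by fun_prop), lintegral_add_right _ measurable_const,
          lintegral_const, measure_univ, mul_one]

theorem le_of_forall_le_add_mul_rpow {X Y K : ℝ≥0∞} (hK : K ≠ ∞) {p : ℝ} (hp : 0 < p)
    (h : ∀ c : ℝ≥0∞, c ≠ 0 → c ≠ ∞ → X ≤ Y + K * c ^ p) : X ≤ Y := by
  refine ENNReal.le_of_forall_pos_le_add fun ε hε _ => ?_
  have hε' : (ε : ℝ≥0∞) ≠ 0 := by simpa using hε.ne'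
  have hK1 : K + 1 ≠ ∞ := by finiteness
  have h0 : (ε : ℝ≥0∞) / (K + 1) ≠ 0 := ENNReal.div_ne_zero.2 ⟨hε', hK1⟩
  have ht : (ε : ℝ≥0∞) / (K + 1) ≠ ∞ := ENNReal.div_ne_top (by simp) (by simp)
  refine (h (((ε : ℝ≥0∞) / (K + 1)) ^ p⁻¹) ?_ ?_).trans ?_
  · exact (ENNReal.rpow_pos (pos_iff_ne_zero.2 h0) ht).ne'
  · exact ENNReal.rpow_ne_top_of_nonneg (by positivity) ht
  · gcongr
    rw [← ENNReal.rpow_mul, inv_mul_cancel₀ hp.ne', ENNReal.rpow_one]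
    calc K * (ε / (K + 1)) ≤ (K + 1) * (ε / (K + 1)) := by gcongr; exact le_self_add
      _ = ε := ENNReal.mul_div_cancel (by simp) hK1

theorem rpow_inv_rpow_eq_rpow_div (r p : ℝ) (a : ℝ≥0∞) : (a ^ r⁻¹) ^ p = a ^ (p / r) := by
  rw [← ENNReal.rpow_mul, div_eq_inv_mul]

theorem rpow_le_rpow_mul_add {G H : ℝ≥0∞} (hH0 : H ≠ 0) (hH : H ≠ ∞) {p r : ℝ} (hp : 0 < p)
    (hpr : p ≤ r) : G ^ p ≤ G ^ r * H ^ (p - r) + H ^ p := by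
  rcases le_total G H with h | h
  · exact (ENNReal.rpow_le_rpow h hp.le).trans le_add_self
  refine le_trans ?_ le_self_add
  have e : H ^ (p - r) = (H ^ (r - p))⁻¹ := by rw [← ENNReal.rpow_neg]; ring_nf
  rw [e, ← div_eq_mul_inv, ENNReal.le_div_iff_mul_le
    (.inl (ENNReal.rpow_pos (pos_iff_ne_zero.2 hH0) hH).ne')
    (.inl (ENNReal.rpow_ne_top_of_nonneg (by linarith) hH))]
  calc G ^ p * H ^ (r - p) ≤ G ^ p * G ^ (r - p) := by
        gcongr
    _ = G ^ r := by rw [← ENNReal.rpow_add_of_nonneg _ _ hp.le (by linarith)]; ring_nf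

/-- The vector-valued maximal inequality for `p ≤ r < ∞`, by means of the weight `H ^ (p - r)`,
where `H` is a maximal function of the right-hand side. -/
theorem exists_lintegral_tsum_partialSups_le_of_le {p r : ℝ} (hp : 1 < p) (hpr : p ≤ r) :
    ∃ K : ℝ≥0, ∀ (Ω : Type*) (mΩ : MeasurableSpace Ω) (μ : Measure Ω) (_ : IsProbabilityMeasure μ)
      (ℱ : Filtration ℕ mΩ) (N : ℕ) (x : ℕ → ℕ → Ω → ℝ≥0∞),
      (∀ k n, Measurable[ℱ n] (x k n)) → (∀ k, ∀ n ≤ N, SetIntLE (ℱ n) μ (x k n) (x k N)) →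
      ∫⁻ ω, (∑' k, partialSups (x k) N ω ^ r) ^ (p / r) ∂μ ≤
        K * ∫⁻ ω, (∑' k, x k N ω ^ r) ^ (p / r) ∂μ := by
  have hr : 1 < r := hp.trans_le hpr
  have hr0 : 0 < r := by linarith
  have hp0 : 0 < p := by linarith
  set q := r.conjExponent
  have hrq : r.HolderConjugate q := .conjExponent hr
  set q' := p.conjExponent
  have hpq' : p.HolderConjugate q' := .conjExponent hp
  set δ : ℝ := (r - p) / (r - 1) with hδdef
  have hδ : 0 ≤ δ := div_nonneg (by linarith) (by linarith)
  have hδ1 : δ < 1 := (div_lt_one (by linarith)).2 (by linarith)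
  have hδr : δ * (1 - r) = p - r := by
    rw [hδdef]; field_simp [(by linarith : r - 1 ≠ 0)]; ring
  set C : ℝ≥0∞ := (ENNReal.ofReal (1 - δ))⁻¹ with hC
  have hCtop : C ≠ ∞ := by simpa [hC] using hδ1
  set B : ℝ≥0∞ := (2 * ENNReal.ofReal q') ^ p with hB
  have hBtop : B ≠ ∞ := ENNReal.rpow_ne_top_of_nonneg hp0.le (by finiteness)
  set D : ℝ≥0∞ := (2 * ENNReal.ofReal q * C) ^ r with hD
  have hDtop : D ≠ ∞ := ENNReal.rpow_ne_top_of_nonneg hr0.le (by finiteness)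
  -- Adding `1` makes the constant nonzero, so that a right-hand side `K * ∞` is infinite.
  set K : ℝ≥0∞ := (D + 1) * (B * 2 ^ (p - 1)) + 1 with hK
  have h2top : (2 : ℝ≥0∞) ^ (p - 1) ≠ ∞ :=
    ENNReal.rpow_ne_top_of_nonneg (by linarith) (by simp)
  have hKtop : K ≠ ∞ := by finiteness
  refine ⟨K.toNNReal, fun Ω mΩ μ _ ℱ N x hx hxN => ?_⟩
  rw [ENNReal.coe_toNNReal hKtop]
  have hxN' : ∀ k, Measurable[ℱ N] (x k N) := fun k => hx k N
  have hxm : ∀ k, Measurable (x k N) := fun k => (hx k N).mono (ℱ.le N) le_rfl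
  have hM : ∀ k, Measurable (partialSups (x k) N) := fun k =>
    (measurable_partialSups_adapted (hx k) N).mono (ℱ.le N) le_rfl
  set F : Ω → ℝ≥0∞ := fun ω => (∑' k, x k N ω ^ r) ^ r⁻¹
  set G : Ω → ℝ≥0∞ := fun ω => (∑' k, partialSups (x k) N ω ^ r) ^ r⁻¹
  have hFm : Measurable[ℱ N] F :=
    measurable_tsum_rpow_rpow hxN' _ _
  have hFm' : Measurable F := hFm.mono (ℱ.le N) le_rfl
  have hFr : ∀ ω, F ω ^ r = ∑' k, x k N ω ^ r := fun ω => ENNReal.rpow_inv_rpow hr0.ne' _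
  have hGr : ∀ ω, G ω ^ r = ∑' k, partialSups (x k) N ω ^ r := fun ω =>
    ENNReal.rpow_inv_rpow hr0.ne' _
  have hFp : ∀ ω, F ω ^ p = (∑' k, x k N ω ^ r) ^ (p / r) :=
    fun ω => rpow_inv_rpow_eq_rpow_div _ _ _
  have hGp : ∀ ω, G ω ^ p = (∑' k, partialSups (x k) N ω ^ r) ^ (p / r) := fun ω =>
    rpow_inv_rpow_eq_rpow_div _ _ _
  simp only [← hFp, ← hGp]
  rcases eq_or_ne (∫⁻ ω, F ω ^ p ∂μ) ∞ with htop | htop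
  · rw [htop, ENNReal.mul_top (by simp [hK])]; exact le_top
  have hF1 := lintegral_ne_top_of_lintegral_rpow_ne_top hp.le htop
  -- The shift by `c` keeps `H` away from zero; the error it causes vanishes as `c` tends to zero.
  refine le_of_forall_le_add_mul_rpow hKtop hp0 fun c hc hc' => ?_
  set H := doobMax ℱ μ F c N
  have hHm : Measurable H := (measurable_doobMax N).mono (ℱ.le N) le_rfl
  have hA1 := isA1Weight_doobMax_rpow (ℱ := ℱ) (μ := μ) hF1 hc hc' hδ hδ1 N
  have hH0 : ∀ ω, H ω ≠ 0 := fun ω =>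
    ((pos_iff_ne_zero.2 hc).trans_le (const_le_doobMax N ω)).ne'
  have hHtop : ∀ᵐ ω ∂μ, H ω ≠ ∞ := (doobMax_ne_top hF1 hc').mono fun ω h => h N
  have hHp : ∫⁻ ω, H ω ^ p ∂μ ≤ B * 2 ^ (p - 1) * (∫⁻ ω, F ω ^ p ∂μ + c ^ p) := by
    refine (lintegral_doobMax_rpow_le hpq' hFm' N).trans ?_
    rw [mul_assoc]
    exact mul_le_mul_right (lintegral_add_const_rpow_le hFm' hp.le c) _
  have hGH : ∫⁻ ω, G ω ^ r * H ω ^ (p - r) ∂μ ≤ D * ∫⁻ ω, H ω ^ p ∂μ := by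
    calc ∫⁻ ω, G ω ^ r * H ω ^ (p - r) ∂μ
        = ∑' k, ∫⁻ ω, partialSups (x k) N ω ^ r * H ω ^ (p - r) ∂μ := by
          simp only [hGr, ← ENNReal.tsum_mul_right]
          exact lintegral_tsum fun k => by fun_prop
      _ ≤ ∑' k, D * ∫⁻ ω, x k N ω ^ r * H ω ^ (p - r) ∂μ := by
          refine ENNReal.tsum_le_tsum fun k => ?_
          have := hA1.lintegral_partialSups_rpow_mul_rpow_le hrq (hx k) (hxm k) (hxN k)
          simpa only [← ENNReal.rpow_mul, hδr] using this
      _ = D * ∫⁻ ω, F ω ^ r * H ω ^ (p - r) ∂μ := by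
          rw [ENNReal.tsum_mul_left, ← lintegral_tsum fun k => by fun_prop]
          simp only [hFr, ENNReal.tsum_mul_right]
      _ ≤ D * ∫⁻ ω, H ω ^ p ∂μ := by
          refine mul_le_mul_right (lintegral_mono_ae ?_) _
          filter_upwards [hHtop] with ω hω
          calc F ω ^ r * H ω ^ (p - r) ≤ H ω ^ r * H ω ^ (p - r) := by
                gcongr; exact le_doobMax hFm ω
            _ = H ω ^ p := by rw [← ENNReal.rpow_add _ _ (hH0 ω) hω]; ring_nf
  calc ∫⁻ ω, G ω ^ p ∂μ ≤ ∫⁻ ω, (G ω ^ r * H ω ^ (p - r) + H ω ^ p) ∂μ := by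
        refine lintegral_mono_ae ?_
        filter_upwards [hHtop] with ω hω using rpow_le_rpow_mul_add (hH0 ω) hω hp0 hpr
    _ = ∫⁻ ω, G ω ^ r * H ω ^ (p - r) ∂μ + ∫⁻ ω, H ω ^ p ∂μ := lintegral_add_right _ (by fun_prop)
    _ ≤ (D + 1) * ∫⁻ ω, H ω ^ p ∂μ := by rw [add_mul, one_mul]; gcongr
    _ ≤ (D + 1) * (B * 2 ^ (p - 1) * (∫⁻ ω, F ω ^ p ∂μ + c ^ p)) := by gcongr
    _ ≤ K * (∫⁻ ω, F ω ^ p ∂μ + c ^ p) := by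
        rw [← mul_assoc]; gcongr; exact le_self_add
    _ = _ := mul_add _ _ _

/-- The vector-valued maximal inequality for `r < p` and finite sums, by means of a weight that
majorizes `G ^ (p - r)`, where `G` is the left-hand side. -/
theorem exists_lintegral_sum_partialSups_le_of_lt {p r : ℝ} (hr : 1 < r) (hrp : r < p) :
    ∃ K : ℝ≥0, ∀ (Ω : Type*) (mΩ : MeasurableSpace Ω) (μ : Measure Ω) (_ : IsProbabilityMeasure μ)
      (ℱ : Filtration ℕ mΩ) (N : ℕ) (x : ℕ → ℕ → Ω → ℝ≥0∞) (S : Finset ℕ),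
      (∀ k n, Measurable[ℱ n] (x k n)) → (∀ k, ∀ n ≤ N, SetIntLE (ℱ n) μ (x k n) (x k N)) →
      ∫⁻ ω, (∑ k ∈ S, partialSups (x k) N ω ^ r) ^ (p / r) ∂μ ≤
        K * ∫⁻ ω, (∑ k ∈ S, x k N ω ^ r) ^ (p / r) ∂μ := by
  have hp : 1 < p := hr.trans hrp
  have hr0 : 0 < r := by linarith
  have hp0 : 0 < p := by linarith
  have hpr0 : 0 < p - r := by linarith
  set q := r.conjExponent
  have hrq : r.HolderConjugate q := .conjExponent hr
  have hpq' : p.HolderConjugate p.conjExponent := .conjExponent hp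
  -- The midpoint of the interval `((p - r) / p, 1)`: the lower bound on `δ` ensures `1 < s`.
  set δ : ℝ := (2 * p - r) / (2 * p) with hδdef
  have hδ0 : 0 < δ := div_pos (by linarith) (by linarith)
  have hδ1 : δ < 1 := (div_lt_one (by linarith)).2 (by linarith)
  have hδp : δ * p = p - r / 2 := by rw [hδdef]; field_simp
  set s : ℝ := δ * p / (p - r) with hsdef
  have hs1 : 1 < s := by rw [hsdef, one_lt_div hpr0, hδp]; linarith
  have hs0 : 0 < s := by linarith
  set q' := s.conjExponent
  have hsq' : s.HolderConjugate q' := .conjExponent hs1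
  set C : ℝ≥0∞ := (ENNReal.ofReal (1 - δ))⁻¹ with hC
  have hCtop : C ≠ ∞ := by simpa [hC] using hδ1
  -- The summand `1` in `B` and in `D` makes both nonzero, and with them `t`.
  set B : ℝ≥0∞ := (2 * ENNReal.ofReal q') ^ s * 2 ^ (s - 1) + 1 with hB
  have h2top : (2 : ℝ≥0∞) ^ (s - 1) ≠ ∞ :=
    ENNReal.rpow_ne_top_of_nonneg (by linarith) (by simp)
  have hBtop : B ≠ ∞ := ENNReal.add_ne_top.2 ⟨ENNReal.mul_ne_top
    (ENNReal.rpow_ne_top_of_nonneg hs0.le (by finiteness)) h2top, by simp⟩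
  set D : ℝ≥0∞ := (2 * ENNReal.ofReal q * C) ^ r + 1 with hD
  have hDtop : D ≠ ∞ :=
    ENNReal.add_ne_top.2 ⟨ENNReal.rpow_ne_top_of_nonneg hr0.le (by finiteness), by simp⟩
  -- With this `t`, the term to be absorbed has coefficient `D * t ^ (-r) * B = 1 / 2`.
  set t : ℝ≥0∞ := (2 * D * B) ^ r⁻¹ with ht
  have hDB0 : 2 * D * B ≠ 0 := by simp [hD, hB]
  have hDBtop : 2 * D * B ≠ ∞ := by finiteness
  have ht0 : t ≠ 0 := (ENNReal.rpow_pos (pos_iff_ne_zero.2 hDB0) hDBtop).ne'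
  have httop : t ≠ ∞ := ENNReal.rpow_ne_top_of_nonneg (by positivity) hDBtop
  have htr : D * t ^ (-r) * B = 2⁻¹ := by
    rw [ENNReal.rpow_neg, ht, ENNReal.rpow_inv_rpow hr0.ne', mul_assoc 2,
      ENNReal.mul_inv (by simp) (by simp)]
    have h1 : D * B ≠ 0 := by simp [hD, hB]
    have h2 : D * B ≠ ∞ := by finiteness
    calc D * (2⁻¹ * (D * B)⁻¹) * B = 2⁻¹ * ((D * B) * (D * B)⁻¹) := by ring
      _ = 2⁻¹ := by rw [ENNReal.mul_inv_cancel h1 h2, mul_one]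
  set K : ℝ≥0∞ := 2 * (D * t ^ (p - r)) with hK
  have htpr : t ^ (p - r) ≠ ∞ := ENNReal.rpow_ne_top_of_nonneg hpr0.le httop
  have htpr0 : t ^ (p - r) ≠ 0 := (ENNReal.rpow_pos (pos_iff_ne_zero.2 ht0) httop).ne'
  have hKtop : K ≠ ∞ := by finiteness
  have hK0 : K ≠ 0 := by simp [hK, hD, htpr0]
  refine ⟨K.toNNReal, fun Ω mΩ μ _ ℱ N x S hx hxN => ?_⟩
  rw [ENNReal.coe_toNNReal hKtop]
  have hxm : ∀ k, Measurable (x k N) := fun k => (hx k N).mono (ℱ.le N) le_rfl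
  have hMN : ∀ k, Measurable[ℱ N] (partialSups (x k) N) := fun k =>
    measurable_partialSups_adapted (hx k) N
  have hM : ∀ k, Measurable (partialSups (x k) N) := fun k => (hMN k).mono (ℱ.le N) le_rfl
  set F : Ω → ℝ≥0∞ := fun ω => (∑ k ∈ S, x k N ω ^ r) ^ r⁻¹ with hF
  set G : Ω → ℝ≥0∞ := fun ω => (∑ k ∈ S, partialSups (x k) N ω ^ r) ^ r⁻¹
  have hFm' : Measurable F :=
    (Finset.measurable_fun_sum _ fun k _ => (hxm k).pow_const r).pow_const _
  have hGm : Measurable[ℱ N] G :=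
    (Finset.measurable_fun_sum _ fun k _ => (hMN k).pow_const r).pow_const _
  have hFr : ∀ ω, F ω ^ r = ∑ k ∈ S, x k N ω ^ r := fun ω => ENNReal.rpow_inv_rpow hr0.ne' _
  have hGr : ∀ ω, G ω ^ r = ∑ k ∈ S, partialSups (x k) N ω ^ r := fun ω =>
    ENNReal.rpow_inv_rpow hr0.ne' _
  have hFp : ∀ ω, F ω ^ p = (∑ k ∈ S, x k N ω ^ r) ^ (p / r) :=
    fun ω => rpow_inv_rpow_eq_rpow_div _ _ _
  have hGp : ∀ ω, G ω ^ p = (∑ k ∈ S, partialSups (x k) N ω ^ r) ^ (p / r) := fun ω =>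
    rpow_inv_rpow_eq_rpow_div _ _ _
  have hpr1 : 1 ≤ p / r := (one_le_div hr0).2 hrp.le
  -- Finiteness of the left-hand side follows from Doob's inequality for each `k`, as the sum is
  -- finite; the bound obtained depends on the number of terms.
  have hGfin : ∫⁻ ω, F ω ^ p ∂μ ≠ ∞ → ∫⁻ ω, G ω ^ p ∂μ ≠ ∞ := fun htop => by
    have h1 : ∀ ω, G ω ^ p ≤
        (S.card : ℝ≥0∞) ^ (p / r - 1) * ∑ k ∈ S, partialSups (x k) N ω ^ p := by
      intro ω
      rw [hGp]
      refine (ENNReal.rpow_sum_le_const_mul_sum_rpow S _ hpr1).trans_eq ?_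
      congr 1
      refine Finset.sum_congr rfl fun k _ => ?_
      rw [← ENNReal.rpow_mul, mul_div_cancel₀ _ hr0.ne']
    refine ne_top_of_le_ne_top ?_ (lintegral_mono h1)
    rw [lintegral_const_mul _ (Finset.measurable_fun_sum _ fun k _ => (hM k).pow_const p),
      lintegral_finsetSum _ fun k _ => (hM k).pow_const p]
    refine ENNReal.mul_ne_top (ENNReal.rpow_ne_top_of_nonneg (by linarith) (by simp))
      (ENNReal.sum_ne_top.2 fun k hk => ?_)
    refine ne_top_of_le_ne_top ?_ (lintegral_partialSups_rpow_le hpq' (hx k) (hxm k) (hxN k))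
    refine ENNReal.mul_ne_top (ENNReal.rpow_ne_top_of_nonneg hp0.le (by finiteness))
      (ne_top_of_le_ne_top htop (lintegral_mono fun ω => ENNReal.rpow_le_rpow ?_ hp0.le))
    rw [hF, ENNReal.le_rpow_inv_iff hr0]
    exact Finset.single_le_sum (f := fun k => x k N ω ^ r) (fun _ _ => zero_le) hk
  simp only [← hFp, ← hGp]
  rcases eq_or_ne (∫⁻ ω, F ω ^ p ∂μ) ∞ with htop | htop
  · rw [htop, ENNReal.mul_top hK0]; exact le_top
  have hGtop := hGfin htop
  refine le_of_forall_le_add_mul_rpow (K := 1) (by simp) hs0 fun c hc hc' => ?_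
  set V : Ω → ℝ≥0∞ := fun ω => G ω ^ ((p - r) / δ) with hV
  have hVm : Measurable[ℱ N] V := hGm.pow_const _
  have hVm' : Measurable V := hVm.mono (ℱ.le N) le_rfl
  have hVs : ∀ ω, V ω ^ s = G ω ^ p := fun ω => by
    rw [hV, ← ENNReal.rpow_mul]; congr 1; rw [hsdef]; field_simp
  have hVδ : ∀ ω, V ω ^ δ = G ω ^ (p - r) := fun ω => by
    rw [hV, ← ENNReal.rpow_mul]; congr 1; field_simp
  have hV1 : ∫⁻ ω, V ω ∂μ ≠ ∞ :=
    lintegral_ne_top_of_lintegral_rpow_ne_top hs1.le (by simpa only [hVs] using hGtop)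
  set H := doobMax ℱ μ V c N
  have hHm : Measurable H := (measurable_doobMax N).mono (ℱ.le N) le_rfl
  have hA1 := isA1Weight_doobMax_rpow (ℱ := ℱ) (μ := μ) hV1 hc hc' hδ0.le hδ1 N
  have hHs : ∫⁻ ω, H ω ^ s ∂μ ≤ B * (∫⁻ ω, G ω ^ p ∂μ + c ^ s) := by
    calc ∫⁻ ω, H ω ^ s ∂μ ≤ (2 * ENNReal.ofReal q') ^ s * ∫⁻ ω, (V ω + c) ^ s ∂μ :=
          lintegral_doobMax_rpow_le hsq' hVm' N
      _ ≤ (2 * ENNReal.ofReal q') ^ s * (2 ^ (s - 1) * (∫⁻ ω, V ω ^ s ∂μ + c ^ s)) := by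
          gcongr; exact lintegral_add_const_rpow_le hVm' hs1.le c
      _ ≤ B * (∫⁻ ω, G ω ^ p ∂μ + c ^ s) := by
          simp only [hVs, ← mul_assoc]; gcongr; exact le_self_add
  have hGG : ∀ ω, G ω ^ p ≤ G ω ^ r * H ω ^ δ := fun ω => by
    calc G ω ^ p = G ω ^ r * G ω ^ (p - r) := by
          rw [← ENNReal.rpow_add_of_nonneg _ _ hr0.le hpr0.le]; ring_nf
      _ ≤ G ω ^ r * H ω ^ δ := by
          rw [← hVδ]; gcongr; exact le_doobMax hVm ω
  have hFH : ∀ ω, F ω ^ r * H ω ^ δ ≤ t ^ (p - r) * F ω ^ p + t ^ (-r) * H ω ^ s := fun ω => by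
    have h := rpow_mul_rpow_le_add (a := F ω) (b := H ω ^ (δ / (p - r))) hr0.le hpr0.le ht0 httop
    have e1 : (H ω ^ (δ / (p - r))) ^ (p - r) = H ω ^ δ := by
      rw [← ENNReal.rpow_mul, div_mul_cancel₀ _ hpr0.ne']
    have e2 : (H ω ^ (δ / (p - r))) ^ p = H ω ^ s := by
      rw [← ENNReal.rpow_mul, div_mul_eq_mul_div]
    rwa [e1, add_sub_cancel, e2] at h
  have main : ∫⁻ ω, G ω ^ p ∂μ ≤ (D * t ^ (p - r) * ∫⁻ ω, F ω ^ p ∂μ + 2⁻¹ * c ^ s) +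
      2⁻¹ * ∫⁻ ω, G ω ^ p ∂μ := by
    calc ∫⁻ ω, G ω ^ p ∂μ ≤ ∫⁻ ω, G ω ^ r * H ω ^ δ ∂μ := lintegral_mono hGG
      _ = ∑ k ∈ S, ∫⁻ ω, partialSups (x k) N ω ^ r * H ω ^ δ ∂μ := by
          simp only [hGr, Finset.sum_mul]
          exact lintegral_finsetSum _ fun k _ => by fun_prop
      _ ≤ ∑ k ∈ S, D * ∫⁻ ω, x k N ω ^ r * H ω ^ δ ∂μ := by
          refine Finset.sum_le_sum fun k _ => ?_
          refine (hA1.lintegral_partialSups_rpow_mul_le hrq (hx k) (hxm k) (hxN k)).trans ?_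
          gcongr; exact le_self_add
      _ = D * ∫⁻ ω, F ω ^ r * H ω ^ δ ∂μ := by
          rw [← Finset.mul_sum, ← lintegral_finsetSum _ fun k _ => by fun_prop]
          simp only [hFr, Finset.sum_mul]
      _ ≤ D * ∫⁻ ω, (t ^ (p - r) * F ω ^ p + t ^ (-r) * H ω ^ s) ∂μ := by
          gcongr with ω; exact hFH ω
      _ = D * t ^ (p - r) * ∫⁻ ω, F ω ^ p ∂μ + D * t ^ (-r) * ∫⁻ ω, H ω ^ s ∂μ := by
          rw [lintegral_add_left (by fun_prop), lintegral_const_mul _ (by fun_prop),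
            lintegral_const_mul _ (by fun_prop), mul_add, mul_assoc, mul_assoc]
      _ ≤ D * t ^ (p - r) * ∫⁻ ω, F ω ^ p ∂μ +
            D * t ^ (-r) * (B * (∫⁻ ω, G ω ^ p ∂μ + c ^ s)) := by gcongr
      _ = _ := by rw [← mul_assoc (D * t ^ (-r)), htr]; ring
  refine (le_two_mul_of_le_add_half hGtop main).trans_eq ?_
  rw [mul_add, ← mul_assoc, ← mul_assoc 2 2⁻¹, ENNReal.mul_inv_cancel (by simp) (by simp)]

theorem exists_lintegral_tsum_partialSups_le {p r : ℝ} (hp : 1 < p) (hr : 1 < r) :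
    ∃ K : ℝ≥0, ∀ (Ω : Type*) (mΩ : MeasurableSpace Ω) (μ : Measure Ω) (_ : IsProbabilityMeasure μ)
      (ℱ : Filtration ℕ mΩ) (N : ℕ) (x : ℕ → ℕ → Ω → ℝ≥0∞),
      (∀ k n, Measurable[ℱ n] (x k n)) → (∀ k, ∀ n ≤ N, SetIntLE (ℱ n) μ (x k n) (x k N)) →
      ∫⁻ ω, (∑' k, partialSups (x k) N ω ^ r) ^ (p / r) ∂μ ≤
        K * ∫⁻ ω, (∑' k, x k N ω ^ r) ^ (p / r) ∂μ := by
  rcases le_or_gt p r with hpr | hrp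
  · exact exists_lintegral_tsum_partialSups_le_of_le hp hpr
  obtain ⟨K, hK⟩ := exists_lintegral_sum_partialSups_le_of_lt hr hrp
  refine ⟨K, fun Ω mΩ μ hμ ℱ N x hx hxN => ?_⟩
  have hpr0 : 0 < p / r := by apply div_pos <;> linarith
  have hM : ∀ k, Measurable (partialSups (x k) N) := fun k =>
    (measurable_partialSups_adapted (hx k) N).mono (ℱ.le N) le_rfl
  have e : ∀ ω, (∑' k, partialSups (x k) N ω ^ r) ^ (p / r) =
      ⨆ n : ℕ, (∑ k ∈ Finset.range n, partialSups (x k) N ω ^ r) ^ (p / r) := fun ω => by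
    rw [ENNReal.tsum_eq_iSup_nat]
    exact (ENNReal.orderIsoRpow _ hpr0).map_iSup _
  simp only [e]
  rw [lintegral_iSup (fun n => (Finset.measurable_fun_sum _ fun k _ =>
    (hM k).pow_const r).pow_const _)]
  · refine iSup_le fun n => (hK Ω mΩ μ hμ ℱ N x (Finset.range n) hx hxN).trans ?_
    gcongr with ω
    exact ENNReal.sum_le_tsum _
  · intro a b hab ω
    exact ENNReal.rpow_le_rpow (Finset.sum_le_sum_of_subset (Finset.range_mono hab)) hpr0.le

theorem ae_le_condLExp_of_setIntLE {Ω : Type*} {m mΩ : MeasurableSpace Ω} {μ : Measure Ω}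
    (hm : m ≤ mΩ) [SigmaFinite (μ.trim hm)] {x h : Ω → ℝ≥0∞} (hx : Measurable[m] x)
    (hxh : SetIntLE m μ x h) : x ≤ᵐ[μ] μ⁻[h|m] := by
  refine ae_le_of_ae_le_trim (hm := hm) ?_
  refine ae_le_of_forall_setLIntegral_le_of_sigmaFinite hx fun s hs _ => ?_
  rw [setLIntegral_condLExp_trim hm μ h hs, setLIntegral_trim hm hx hs]
  exact hxh s hs

/-- The vector-valued maximal inequality for `r = ∞`: all the processes are dominated by the
martingale that closes at `⨆ k, x k N`. -/
theorem lintegral_iSup_partialSups_rpow_le {Ω : Type*} {mΩ : MeasurableSpace Ω} {μ : Measure Ω}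
    [IsFiniteMeasure μ] {ℱ : Filtration ℕ mΩ} {p q : ℝ} (hpq : p.HolderConjugate q) {N : ℕ}
    {x : ℕ → ℕ → Ω → ℝ≥0∞} (hx : ∀ k n, Measurable[ℱ n] (x k n))
    (hxN : ∀ k, ∀ n ≤ N, SetIntLE (ℱ n) μ (x k n) (x k N)) :
    ∫⁻ ω, (⨆ k, partialSups (x k) N ω) ^ p ∂μ ≤
      (2 * ENNReal.ofReal q) ^ p * ∫⁻ ω, (⨆ k, x k N ω) ^ p ∂μ := by
  set F : Ω → ℝ≥0∞ := fun ω => ⨆ k, x k N ω with hF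
  have hFm : Measurable F := Measurable.iSup fun k => (hx k N).mono (ℱ.le N) le_rfl
  have h1 : ∀ᵐ ω ∂μ, ∀ k n, n ≤ N → x k n ω ≤ μ⁻[F|ℱ n] ω + 0 := by
    simp only [ae_all_iff]
    intro k n hn
    have : SetIntLE (ℱ n) μ (x k n) F := fun s hs =>
      (hxN k n hn s hs).trans (lintegral_mono fun ω => le_iSup (fun k => x k N ω) k)
    filter_upwards [ae_le_condLExp_of_setIntLE (ℱ.le n) (hx k n) this] with ω h
    rwa [add_zero]
  calc ∫⁻ ω, (⨆ k, partialSups (x k) N ω) ^ p ∂μ ≤ ∫⁻ ω, doobMax ℱ μ F 0 N ω ^ p ∂μ := by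
        refine lintegral_mono_ae ?_
        filter_upwards [h1] with ω hω
        refine ENNReal.rpow_le_rpow (iSup_le fun k => ?_) hpq.pos.le
        rw [Pi.partialSups_apply]
        exact partialSups_le (fun n => x k n ω) _ _ fun n hn => (hω k n hn).trans
          (le_partialSups_of_le (fun n ω => μ⁻[F|ℱ n] ω + 0) hn ω)
    _ ≤ (2 * ENNReal.ofReal q) ^ p * ∫⁻ ω, (F ω + 0) ^ p ∂μ := lintegral_doobMax_rpow_le hpq hFm N
    _ = _ := by simp only [add_zero, hF]

/-! ### The inequality for martingales -/

/-- The norm of a Banach space valued martingale is a submartingale. -/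
theorem MeasureTheory.Martingale.setIntLE_enorm {Ω E : Type*} {mΩ : MeasurableSpace Ω}
    {μ : Measure Ω} [IsFiniteMeasure μ] {ℱ : Filtration ℕ mΩ} [NormedAddCommGroup E]
    [NormedSpace ℝ E] [CompleteSpace E] {f : ℕ → Ω → E} (hf : Martingale f ℱ μ) {n N : ℕ}
    (h : n ≤ N) : SetIntLE (ℱ n) μ (fun ω => ‖f n ω‖ₑ) (fun ω => ‖f N ω‖ₑ) := fun s hs => by
  have h1 : ∫ ω in s, ‖f n ω‖ ∂μ ≤ ∫ ω in s, ‖f N ω‖ ∂μ := by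
    refine le_trans (le_of_eq ?_) (setIntegral_norm_condExp_le hs (f N))
    refine integral_congr_ae (ae_restrict_of_ae ?_)
    filter_upwards [hf.condExp_ae_eq h] with ω hω
    rw [hω]
  rw [← ofReal_integral_norm_eq_lintegral_enorm (hf.integrable n).restrict,
    ← ofReal_integral_norm_eq_lintegral_enorm (hf.integrable N).restrict]
  exact ENNReal.ofReal_le_ofReal h1

theorem eLpNorm_iSup_le_of_monotone {α : Type*} {mα : MeasurableSpace α} {μ : Measure α}
    {g : ℕ → α → ℝ≥0∞} (hg : ∀ n, Measurable (g n)) (hmono : Monotone g) (p : ℝ≥0∞) :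
    eLpNorm (fun a => ⨆ n, g n a) p μ ≤ ⨆ n, eLpNorm (g n) p μ := by
  rcases eq_or_ne p 0 with rfl | hp0
  · simp
  rcases eq_or_ne p ∞ with rfl | hp
  · simp only [eLpNorm_exponent_top]
    refine essSup_le_of_ae_le _ ?_
    have : ∀ᵐ a ∂μ, ∀ n, g n a ≤ eLpNormEssSup (g n) μ := by
      rw [ae_all_iff]; exact fun n => enorm_ae_le_eLpNormEssSup (g n) μ
    filter_upwards [this] with a ha
    exact iSup_mono ha
  have hp' : 0 < p.toReal := ENNReal.toReal_pos hp0 hp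
  simp only [eLpNorm_eq_lintegral_rpow_enorm_toReal hp0 hp, enorm_eq_self]
  have e1 : ∀ a, (⨆ n, g n a) ^ p.toReal = ⨆ n, g n a ^ p.toReal := fun a =>
    (ENNReal.orderIsoRpow _ hp').map_iSup _
  simp only [e1]
  rw [lintegral_iSup (fun n => (hg n).pow_const _)
    (fun a b hab ω => ENNReal.rpow_le_rpow (hmono hab ω) hp'.le)]
  exact ((ENNReal.orderIsoRpow _ (one_div_pos.2 hp')).map_iSup _).le

theorem ellNorm_top {Ω E : Type*} [ENorm E] (X : ℕ → Ω → E) (ω : Ω) :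
    ellNorm ∞ X ω = ⨆ k, ‖X k ω‖ₑ := by
  rw [ellNorm, eLpNorm_exponent_top, eLpNormEssSup_count]

theorem ellNorm_eq_tsum {Ω E : Type*} [ENorm E] {r : ℝ≥0∞} (hr0 : r ≠ 0) (hr : r ≠ ∞)
    (X : ℕ → Ω → E) (ω : Ω) :
    ellNorm r X ω = (∑' k, ‖X k ω‖ₑ ^ r.toReal) ^ r.toReal⁻¹ := by
  rw [ellNorm, eLpNorm_eq_lintegral_rpow_enorm_toReal hr0 hr, lintegral_count, one_div]

theorem measurable_ellNorm {Ω : Type*} {mΩ : MeasurableSpace Ω} {r : ℝ≥0∞} (hr0 : r ≠ 0)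
    {X : ℕ → Ω → ℝ≥0∞} (hX : ∀ k, Measurable (X k)) : Measurable (ellNorm r X) := by
  rcases eq_or_ne r ∞ with rfl | hr
  · simp only [funext (ellNorm_top X), enorm_eq_self]
    exact Measurable.iSup hX
  · simp only [funext (ellNorm_eq_tsum hr0 hr X), enorm_eq_self]
    exact measurable_tsum_rpow_rpow hX _ _

theorem maximalProcess_eq_partialSups {Ω E : Type*} [ENorm E] (f : ℕ → Ω → E) (n : ℕ) :
    maximalProcess f n = partialSups (fun j ω => ‖f j ω‖ₑ) n := by
  ext ω
  rw [Pi.partialSups_apply, partialSups_eq_biSup, maximalProcess]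

theorem eLpNorm_ellNorm_iSup_le {Ω : Type*} {mΩ : MeasurableSpace Ω} {μ : Measure Ω}
    {p r : ℝ≥0∞} (hr0 : r ≠ 0) {X : ℕ → ℕ → Ω → ℝ≥0∞} (hX : ∀ k n, Measurable (X k n))
    (hmono : ∀ k, Monotone (X k)) :
    eLpNorm (ellNorm r fun k ω => ⨆ n, X k n ω) p μ ≤
      ⨆ n, eLpNorm (ellNorm r fun k => X k n) p μ := by
  have h1 : ∀ ω, ellNorm r (fun k ω => ⨆ n, X k n ω) ω ≤ ⨆ n, ellNorm r (fun k => X k n) ω :=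
    fun ω => eLpNorm_iSup_le_of_monotone (g := fun n k => X k n ω) (fun n => .of_discrete)
      (fun a b hab k => hmono k hab ω) r
  refine (eLpNorm_mono_enorm fun ω => ?_).trans
    (eLpNorm_iSup_le_of_monotone (fun n => measurable_ellNorm hr0 fun k => hX k n)
      (fun a b hab ω => eLpNorm_mono_enorm fun k => hmono k hab ω) p)
  simpa only [enorm_eq_self] using h1 ω

theorem exists_eLpNorm_ellNorm_partialSups_le {p r : ℝ≥0∞} (hp : 1 < p) (hp' : p < ∞)
    (hr : 1 < r) :
    ∃ C : ℝ≥0, ∀ (Ω : Type*) (mΩ : MeasurableSpace Ω) (μ : Measure Ω) (_ : IsProbabilityMeasure μ)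
      (ℱ : Filtration ℕ mΩ) (N : ℕ) (x : ℕ → ℕ → Ω → ℝ≥0∞),
      (∀ k n, Measurable[ℱ n] (x k n)) → (∀ k, ∀ n ≤ N, SetIntLE (ℱ n) μ (x k n) (x k N)) →
      eLpNorm (ellNorm r fun k => partialSups (x k) N) p μ ≤
        C * eLpNorm (ellNorm r fun k => x k N) p μ := by
  have hp0 : p ≠ 0 := (zero_lt_one.trans hp).ne'
  have hr0 : r ≠ 0 := (zero_lt_one.trans hr).ne'
  have hP : 1 < p.toReal := by
    rw [← ENNReal.toReal_one]; exact (ENNReal.toReal_lt_toReal (by simp) hp'.ne).2 hp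
  have hP0 : 0 < p.toReal := by linarith
  suffices H : ∃ K : ℝ≥0, ∀ (Ω : Type _) (mΩ : MeasurableSpace Ω) (μ : Measure Ω)
      (_ : IsProbabilityMeasure μ) (ℱ : Filtration ℕ mΩ) (N : ℕ) (x : ℕ → ℕ → Ω → ℝ≥0∞),
      (∀ k n, Measurable[ℱ n] (x k n)) → (∀ k, ∀ n ≤ N, SetIntLE (ℱ n) μ (x k n) (x k N)) →
      ∫⁻ ω, ellNorm r (fun k => partialSups (x k) N) ω ^ p.toReal ∂μ ≤
        K * ∫⁻ ω, ellNorm r (fun k => x k N) ω ^ p.toReal ∂μ by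
    obtain ⟨K, hK⟩ := H
    refine ⟨K ^ (1 / p.toReal), fun Ω mΩ μ hμ ℱ N x hx hxN => ?_⟩
    simp only [eLpNorm_eq_lintegral_rpow_enorm_toReal hp0 hp'.ne, enorm_eq_self]
    rw [ENNReal.coe_rpow_of_nonneg _ (by positivity),
      ← ENNReal.mul_rpow_of_nonneg _ _ (by positivity)]
    exact ENNReal.rpow_le_rpow (hK Ω mΩ μ hμ ℱ N x hx hxN) (by positivity)
  rcases eq_or_ne r ∞ with rfl | hrt
  · have hK : (2 * ENNReal.ofReal p.toReal.conjExponent) ^ p.toReal ≠ ∞ :=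
      ENNReal.rpow_ne_top_of_nonneg hP0.le (by finiteness)
    refine ⟨((2 * ENNReal.ofReal p.toReal.conjExponent) ^ p.toReal).toNNReal,
      fun Ω mΩ μ hμ ℱ N x hx hxN => ?_⟩
    rw [ENNReal.coe_toNNReal hK]
    simp only [ellNorm_top, enorm_eq_self]
    exact lintegral_iSup_partialSups_rpow_le (.conjExponent hP) hx hxN
  · have hR : 1 < r.toReal := by
      rw [← ENNReal.toReal_one]; exact (ENNReal.toReal_lt_toReal (by simp) hrt).2 hr
    obtain ⟨K, hK⟩ := exists_lintegral_tsum_partialSups_le hP hR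
    refine ⟨K, fun Ω mΩ μ hμ ℱ N x hx hxN => ?_⟩
    simp only [ellNorm_eq_tsum hr0 hrt, enorm_eq_self, rpow_inv_rpow_eq_rpow_div]
    exact hK Ω mΩ μ hμ ℱ N x hx hxN

theorem mainTheorem6 (p r : ℝ≥0∞) (hp : 1 < p) (hp' : p < ∞) (hr : 1 < r) :
    ∃ C : ℝ≥0, ∀ (Ω : Type*) (mΩ : MeasurableSpace Ω) (μ : Measure Ω) (_ : IsProbabilityMeasure μ)
      (ℱ : Filtration ℕ mΩ)
      (E : Type*) (_ : NormedAddCommGroup E) (_ : NormedSpace ℝ E) (_ : CompleteSpace E)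
      (f : ℕ → ℕ → Ω → E), (∀ k, Martingale (f k) ℱ μ) →
        mixedNorm p r (fun k => maximalProcess (f k)) μ ≤ C * mixedNorm p r f μ ∧
        eLpNorm (ellNorm r (fun k ω => ⨆ n : ℕ, ‖f k n ω‖ₑ)) p μ ≤ C * mixedNorm p r f μ := by
  obtain ⟨C, hC⟩ := exists_eLpNorm_ellNorm_partialSups_le hp hp' hr
  refine ⟨C, fun Ω mΩ μ hμ ℱ E _ _ _ f hf => ?_⟩
  set x : ℕ → ℕ → Ω → ℝ≥0∞ := fun k n ω => ‖f k n ω‖ₑ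
  have hxm : ∀ k n, Measurable[ℱ n] (x k n) := fun k n => ((hf k).stronglyAdapted n).enorm
  have hmax : ∀ k n, maximalProcess (f k) n = partialSups (x k) n := fun k n =>
    maximalProcess_eq_partialSups (f k) n
  have hell : ∀ n, ellNorm r (fun k => x k n) = ellNorm r fun k => f k n := fun n => by
    ext ω
    exact eLpNorm_congr_enorm_ae (.of_forall fun k => enorm_eq_self _)
  have h1 : ⨆ n, eLpNorm (ellNorm r fun k => partialSups (x k) n) p μ ≤
      C * mixedNorm p r f μ := by
    refine iSup_le fun n => (hC Ω mΩ μ hμ ℱ n x hxm fun k m hm => (hf k).setIntLE_enorm hm).trans ?_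
    rw [hell]
    exact mul_le_mul_right (le_iSup (fun n => eLpNorm (ellNorm r fun k => f k n) p μ) n) _
  refine ⟨?_, ?_⟩
  · simpa only [mixedNorm, hmax] using h1
  · refine le_trans ?_ h1
    have e : (fun k ω => ⨆ n, ‖f k n ω‖ₑ) = fun k ω => ⨆ n, partialSups (x k) n ω := by
      funext k ω
      rw [← iSup_apply, iSup_partialSups_eq, iSup_apply]
    rw [e]
    exact eLpNorm_ellNorm_iSup_le (zero_lt_one.trans hr).ne'
      (fun k n => (measurable_partialSups_adapted (hxm k) n).mono (ℱ.le n) le_rfl)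
      fun k => (partialSups (x k)).mono
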